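/- Let $X$ be a countable set. A graph over $X$ is a symmetric map $b:X\times X\to[0,\infty)$ with $b(x,x)=0$ and $\sum_{y\in X}b(x,y)<\infty$ for all $x\in X$; vertices $x,y$ are adjacent if $b(x,y)>0$, and $b$ is locally finite if every vertex has only finitely many neighbours. For $f:X\to\mathbb R$ put $Q(f)=\frac12\sum_{x,y\in X}b(x,y)(f(x)-f(y))^2\in[0,\infty]$, and define the resistance metric $$R(x,y)=\sup_{f:X\to\mathbb R}\frac{(f(y)-f(x))^2}{Q(f)}\in[0,\infty],$$ with the conventions $0/0=0$, $c/0=\infty$ for $c>0$, and $c/\infty=0$ for $0\le c<\infty$. A weight on $X$ is a symmetric function $w:X\times X\to[0,\infty]$ with $w(x,y)=0$ if and only if $x=y$; it is compatible to $b$ if $w(x,y)=\infty$ whenever $b(x,y)=0$ and $x\neq y$. It induces the path (pseudo) metric $$\delta_w(x,y)=\inf\Big\{\sum_{i=1}^n w(x_{i-1},x_i)\ :\ n\ge 0,\ x_0,\dots,x_n\in X\text{ pairwise distinct},\ x_0=x,\ x_n=y\Big\}.$$ A block graph is a graph in which any two vertices are joined by a unique induced path, i.e. a unique path of pairwise distinct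 vertices, consecutive ones being adjacent and non-consecutive ones being non-adjacent. **Theorem 3.4.** Let $b$ be a locally finite graph over $X$. Then $R=\delta_w$ for some weight $w$ compatible to $b$ if and only if every connected component of $b$ is a block graph. In particular, if $b$ is connected, then $R=\delta_w$ for some weight $w$ compatible to $b$ if and only if $b$ is a block graph. -/

import Mathlib

open scoped NNReal ENNReal

/-- A (weighted) graph over `X`: a symmetric map `b : X × X → [0, ∞)` with zero diagonal and
`∑_y b(x, y) < ∞` for every `x`. -/
structure WGraph (X : Type*) where
  b : X → X → ℝ≥0
  symm : ∀ x y, b x y = b y x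
  diag : ∀ x, b x x = 0
  summable : ∀ x, Summable (b x)

namespace WGraph

variable {X : Type*}

/-- The underlying simple graph: `x ∼ y` iff `b(x, y) > 0`. -/
def toSimpleGraph (b : WGraph X) : SimpleGraph X where
  Adj x y := 0 < b.b x y
  symm := ⟨fun x y h => by rw [b.symm y x]; exact h⟩
  loopless := ⟨fun x h => by rw [b.diag x] at h; exact lt_irrefl _ h⟩

/-- Every vertex has only finitely many neighbours. -/
def LocallyFinite (b : WGraph X) : Prop :=
  ∀ x, {y | 0 < b.b x y}.Finite

/-- The energy `Q(f) = 1/2 ∑_{x,y} b(x,y) (f(x) - f(y))² ∈ [0, ∞]`. -/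
noncomputable def energy (b : WGraph X) (f : X → ℝ) : ℝ≥0∞ :=
  2⁻¹ * ∑' x, ∑' y, (b.b x y : ℝ≥0∞) * ENNReal.ofReal ((f x - f y) ^ 2)

/-- The resistance metric `R(x,y) = sup_f (f(y) - f(x))² / Q(f) ∈ [0, ∞]`. In `ℝ≥0∞` one has
`0 / 0 = 0`, `c / 0 = ∞` for `c ≠ 0`, and `c / ∞ = 0` for finite `c`, so functions of infinite
energy and constant functions do not contribute. -/
noncomputable def resistance (b : WGraph X) (x y : X) : ℝ≥0∞ :=
  ⨆ f : X → ℝ, ENNReal.ofReal ((f y - f x) ^ 2) / b.energy f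

/-- `w` is compatible to `b` if `w(x,y) = ∞` whenever `b(x,y) = 0` and `x ≠ y`. -/
def Compatible (b : WGraph X) (w : X → X → ℝ≥0∞) : Prop :=
  ∀ x y, b.b x y = 0 → x ≠ y → w x y = ∞

end WGraph

/-- A weight function on `X`: symmetric, and zero exactly on the diagonal. -/
structure IsWeight {X : Type*} (w : X → X → ℝ≥0∞) : Prop where
  symm : ∀ x y, w x y = w y x
  eq_zero_iff : ∀ x y, w x y = 0 ↔ x = y

/-- The path (pseudo) metric `δ_w`: the infimum of `∑_{i=1}^n w(x_{i-1}, x_i)` over all `n ≥ 0` and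
all injective sequences `(x_0, …, x_n)` of vertices with `x_0 = x` and `x_n = y`. -/
noncomputable def pathMetric {X : Type*} (w : X → X → ℝ≥0∞) (x y : X) : ℝ≥0∞ :=
  ⨅ (n : ℕ) (γ : Fin (n + 1) → X) (_ : Function.Injective γ) (_ : γ 0 = x)
    (_ : γ (Fin.last n) = y), ∑ i : Fin n, w (γ i.castSucc) (γ i.succ)

/-- A walk is an induced path if it does not repeat vertices and any two adjacent vertices on it
are joined by an edge of it, i.e. the subgraph induced on its vertices is the path itself. -/
def SimpleGraph.Walk.IsInducedPath {X : Type*} {G : SimpleGraph X} {x y : X} (p : G.Walk x y) :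
    Prop :=
  p.IsPath ∧ p.IsChordless

namespace WGraph

variable {X : Type*}

/-- A block graph: any two vertices are joined by a unique induced path. -/
def IsBlockGraph (b : WGraph X) : Prop :=
  ∀ x y, ∃! p : b.toSimpleGraph.Walk x y, p.IsInducedPath

/-- Every connected component is a block graph: any two vertices in the same connected component
are joined by a unique induced path. -/
def IsComponentwiseBlockGraph (b : WGraph X) : Prop :=
  ∀ x y, b.toSimpleGraph.Reachable x y → ∃! p : b.toSimpleGraph.Walk x y, p.IsInducedPath

end WGraph

/-! Everything rests on when the triangle inequality for `R` is sharp: for `R(x,z)` finite, `R(x,y)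
+ R(y,z) = R(x,z)` holds exactly when every walk from `x` to `z` meets `y`. If `y` separates,
near-optimal functions for the two halves can be glued at `y` (`resistance_add_le_of_separates`).
Conversely, truncating an energy minimiser for `x, z` at its level in `y` gives a minimiser for `x,
y` that is maximal at `z`; the maximum principle carries this maximum along any walk avoiding `y`
back to `x`, which is absurd (`mem_support_of_resistance_add_le`).

In a block graph the second vertex of the induced path is such a separator, so `R` is additive along
induced paths, and the weight equal to `R` on edges and `∞` on non-adjacent distinct pairs induces
it. If `R = δ_w`, local finiteness yields a neighbour of `x` on a geodesic to `z`. It lies on every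
walk, so it is the second vertex of every induced path, and induction gives uniqueness. -/

namespace SimpleGraph.Walk

variable {V : Type*} {G : SimpleGraph V}

/-! ### Induced paths and their uniqueness -/

theorem IsInducedPath.nil (u : V) : (Walk.nil : G.Walk u u).IsInducedPath := by
  refine ⟨IsPath.nil, isChordless_iff_forall_mem_edges.2 ?_⟩
  intro a b ha hb hab
  simp only [support_nil, List.mem_singleton] at ha hb
  subst ha hb
  exact absurd hab (G.irrefl)

theorem IsInducedPath.of_cons {u v w : V} {h : G.Adj u v} {p : G.Walk v w}
    (hp : (cons h p).IsInducedPath) : p.IsInducedPath := by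
  obtain ⟨h1, h2⟩ := hp
  rw [cons_isPath_iff] at h1
  refine ⟨h1.1, isChordless_iff_forall_mem_edges.2 ?_⟩
  intro a b ha hb hab
  have := h2.mem_edges (u' := a) (v' := b) (by simp [ha]) (by simp [hb]) hab
  rw [edges_cons, List.mem_cons] at this
  rcases this with h | h
  · rw [Sym2.eq_iff] at h
    rcases h with ⟨rfl, rfl⟩ | ⟨rfl, rfl⟩
    · exact absurd ha h1.2
    · exact absurd hb h1.2
  · exact h

/-- Chordlessness puts the edge from `u` to `y` on the path, and the only path edge at the initial
vertex is the first one. -/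
theorem IsInducedPath.eq_snd_of_adj {u v w y : V} {h : G.Adj u v} {p : G.Walk v w}
    (hp : (cons h p).IsInducedPath) (hy : y ∈ (cons h p).support) (huy : G.Adj u y) : y = v := by
  obtain ⟨h1, h2⟩ := hp
  rw [cons_isPath_iff] at h1
  have := h2.mem_edges (start_mem_support _) hy huy
  rw [edges_cons, List.mem_cons] at this
  rcases this with h | h
  · rw [Sym2.eq_iff] at h
    rcases h with ⟨_, h⟩ | ⟨h, h'⟩
    · exact h
    · exact h'.trans h
  · exact absurd (p.fst_mem_support_of_mem_edges h) h1.2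

/-- An induced path can be prolonged backwards to a neighbour of one of its vertices, skipping
initial vertices if necessary. -/
theorem IsInducedPath.exists_extend {v w : V} {q : G.Walk v w} (hq : q.IsInducedPath) {x : V}
    (hx : x ∉ q.support) (hadj : ∃ a ∈ q.support, G.Adj x a) :
    ∃ p : G.Walk x w, p.IsInducedPath ∧ ∀ a ∈ p.support, a = x ∨ a ∈ q.support := by
  induction q with
  | nil =>
    rename_i u
    obtain ⟨a, ha, hxa⟩ := hadj
    simp only [support_nil, List.mem_singleton] at ha
    subst ha
    refine ⟨hxa.toWalk, ⟨by simp [cons_isPath_iff, hxa.ne], hxa.isChordless_toWalk⟩, by simp⟩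
  | cons h q ih =>
    rename_i u v w
    -- The recursion attaches `x` to its last neighbour on the path, so no later vertex can create a
    -- chord.
    by_cases hex : ∃ a ∈ q.support, G.Adj x a
    · obtain ⟨p, hp, hps⟩ := ih hq.of_cons (fun h' => hx (by simp [h'])) hex
      refine ⟨p, hp, fun a ha => ?_⟩
      rcases hps a ha with h' | h'
      · exact Or.inl h'
      · exact Or.inr (by simp [h'])
    · push Not at hex
      obtain ⟨a, ha, hxa⟩ := hadj
      rw [support_cons, List.mem_cons] at ha
      obtain rfl : a = u := ha.resolve_right fun h' => hex a h' hxa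
      refine ⟨cons hxa (cons h q), ⟨(cons_isPath_iff _ _).2 ⟨hq.1, hx⟩,
        isChordless_iff_forall_mem_edges.2 ?_⟩, fun c hc => ?_⟩
      · intro c d hc hd hcd
        rw [support_cons, List.mem_cons] at hc hd
        rw [edges_cons, List.mem_cons]
        have key : ∀ e ∈ (cons h q).support, G.Adj x e → e = a := by
          intro e he hxe
          rw [support_cons, List.mem_cons] at he
          exact he.resolve_right fun h' => hex e h' hxe
        rcases hc with rfl | hc <;> rcases hd with rfl | hd
        · exact absurd hcd G.irrefl
        · rw [key d hd hcd]; exact Or.inl rfl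
        · rw [key c hc hcd.symm]; exact Or.inl Sym2.eq_swap
        · exact Or.inr (hq.2.mem_edges hc hd hcd)
      · rw [support_cons, List.mem_cons] at hc
        exact hc

theorem IsInducedPath.exists_of_mem {v w : V} {q : G.Walk v w} (hq : q.IsInducedPath) {x : V}
    (hx : x ∈ q.support) :
    ∃ p : G.Walk x w, p.IsInducedPath ∧ ∀ a ∈ p.support, a ∈ q.support := by
  induction q with
  | nil =>
    simp only [support_nil, List.mem_singleton] at hx
    subst hx
    exact ⟨Walk.nil, IsInducedPath.nil _, by simp⟩
  | cons h q ih =>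
    by_cases hxq : x ∈ q.support
    · obtain ⟨p, hp, hps⟩ := ih hq.of_cons hxq
      exact ⟨p, hp, fun a ha => by simp [hps a ha]⟩
    · rw [support_cons, List.mem_cons] at hx
      obtain rfl := hx.resolve_right hxq
      exact ⟨cons h q, hq, fun a ha => ha⟩

/-- Every walk can be shortened to an induced path. -/
theorem exists_isInducedPath {v w : V} (q : G.Walk v w) :
    ∃ p : G.Walk v w, p.IsInducedPath ∧ ∀ a ∈ p.support, a ∈ q.support := by
  induction q with
  | nil => exact ⟨Walk.nil, IsInducedPath.nil _, by simp⟩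
  | cons h q ih =>
    rename_i u v w
    obtain ⟨p, hp, hps⟩ := ih
    by_cases hu : u ∈ p.support
    · obtain ⟨p', hp', hps'⟩ := hp.exists_of_mem hu
      exact ⟨p', hp', fun a ha => by simp [hps a (hps' a ha)]⟩
    · obtain ⟨p', hp', hps'⟩ := hp.exists_extend hu ⟨v, p.start_mem_support, h⟩
      refine ⟨p', hp', fun a ha => ?_⟩
      rcases hps' a ha with rfl | h'
      · simp
      · simp [hps a h']

/-- If the induced path between two vertices is unique, then every walk between them passes
through its second vertex. -/
theorem snd_mem_support_of_unique {u v w : V} {h : G.Adj u v} {p : G.Walk v w}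
    (huniq : ∀ q : G.Walk u w, q.IsInducedPath → q = cons h p) (q : G.Walk u w) :
    v ∈ q.support := by
  obtain ⟨q', hq', hs⟩ := q.exists_isInducedPath
  apply hs
  rw [huniq q' hq']
  simp

/-- If every pair of distinct reachable vertices `x, z` admits a neighbour of `x` lying on all walks
from `x` to `z`, then induced paths are unique. -/
theorem IsInducedPath.unique
    (H : ∀ x z, G.Reachable x z → x ≠ z → ∃ y, G.Adj x y ∧ ∀ q : G.Walk x z, y ∈ q.support)
    {x z : V} {p q : G.Walk x z} (hp : p.IsInducedPath) (hq : q.IsInducedPath) : p = q := by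
  induction p with
  | nil => exact (isPath_iff_nil.1 hq.1).eq_nil.symm
  | cons h p ih =>
    rename_i u v w
    have huw : u ≠ w := by
      rintro rfl
      exact ((cons_isPath_iff _ _).1 hp.1).2 p.end_mem_support
    obtain ⟨y, hxy, hy⟩ := H u w ⟨cons h p⟩ huw
    -- `y` lies on both paths and is adjacent to `u`, hence is the second vertex of each.
    obtain rfl := hp.eq_snd_of_adj (hy _) hxy
    cases q with
    | nil => exact absurd rfl huw
    | cons h' q =>
      obtain rfl := hq.eq_snd_of_adj (hy _) hxy
      rw [ih hp.of_cons hq.of_cons]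

end SimpleGraph.Walk

/-! ### Energy estimates; finiteness and triangle inequality of the resistance -/

namespace WGraph

variable {X : Type*} (b : WGraph X)

/-- The comparison is required on edges only, which permits functions glued along a cut vertex or
jumping between components. -/
theorem energy_le_add {f g h : X → ℝ} {α β : ℝ} (hα : 0 ≤ α) (hβ : 0 ≤ β)
    (H : ∀ x y, 0 < b.b x y → (h x - h y) ^ 2 ≤ α * (f x - f y) ^ 2 + β * (g x - g y) ^ 2) :
    b.energy h ≤ ENNReal.ofReal α * b.energy f + ENNReal.ofReal β * b.energy g := by
  have key : ∑' x, ∑' y, (b.b x y : ℝ≥0∞) * ENNReal.ofReal ((h x - h y) ^ 2) ≤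
      ENNReal.ofReal α * (∑' x, ∑' y, (b.b x y : ℝ≥0∞) * ENNReal.ofReal ((f x - f y) ^ 2)) +
      ENNReal.ofReal β * ∑' x, ∑' y, (b.b x y : ℝ≥0∞) * ENNReal.ofReal ((g x - g y) ^ 2) := by
    simp_rw [← ENNReal.tsum_mul_left, ← ENNReal.tsum_add]
    refine ENNReal.tsum_le_tsum fun x => ENNReal.tsum_le_tsum fun y => ?_
    rcases eq_or_lt_of_le (zero_le (a := b.b x y)) with h0 | h0
    · simp [← h0]
    · rw [mul_left_comm _ (b.b x y : ℝ≥0∞), mul_left_comm _ (b.b x y : ℝ≥0∞), ← mul_add,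
        ← ENNReal.ofReal_mul hα, ← ENNReal.ofReal_mul hβ,
        ← ENNReal.ofReal_add (by positivity) (by positivity)]
      gcongr
      exact H x y h0
  unfold energy
  rw [mul_left_comm _ (2⁻¹ : ℝ≥0∞), mul_left_comm _ (2⁻¹ : ℝ≥0∞), ← mul_add]
  gcongr

theorem energy_le_mul {f h : X → ℝ} {α : ℝ} (hα : 0 ≤ α)
    (H : ∀ x y, (h x - h y) ^ 2 ≤ α * (f x - f y) ^ 2) :
    b.energy h ≤ ENNReal.ofReal α * b.energy f := by
  simpa using b.energy_le_add (g := f) hα le_rfl (fun x y _ => by simpa using H x y)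

theorem energy_add_le {f u v : X → ℝ}
    (H : ∀ x y, (u x - u y) ^ 2 + (v x - v y) ^ 2 ≤ (f x - f y) ^ 2) :
    b.energy u + b.energy v ≤ b.energy f := by
  unfold energy
  rw [← mul_add]
  simp_rw [← ENNReal.tsum_add]
  gcongr with x y
  rw [← mul_add, ← ENNReal.ofReal_add (by positivity) (by positivity)]
  gcongr
  exact H x y

/-- Truncating a function from below and above at the same level splits its energy. -/
theorem energy_min_add_energy_max_le (f : X → ℝ) (t : ℝ) :
    b.energy (fun a => min (f a) t) + b.energy (fun a => max (f a) t) ≤ b.energy f := by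
  refine b.energy_add_le fun x y => ?_
  -- On the same side of `t` one truncation is constant; across `t` the claim is `a ^ 2 + b ^ 2 ≤ (a
  -- + b) ^ 2` for `a, b ≥ 0`.
  rcases le_total (f x) t with h1 | h1 <;> rcases le_total (f y) t with h2 | h2 <;>
    simp only [min_eq_left, min_eq_right, max_eq_left, max_eq_right, h1, h2] <;> nlinarith

theorem sq_le_toReal_mul {x y : X} (hR : b.resistance x y ≠ ∞) {f : X → ℝ}
    (hf : b.energy f ≠ ∞) :
    (f y - f x) ^ 2 ≤ (b.resistance x y).toReal * (b.energy f).toReal := by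
  have h : ENNReal.ofReal ((f y - f x) ^ 2) / b.energy f ≤ b.resistance x y :=
    le_iSup (fun f : X → ℝ => ENNReal.ofReal ((f y - f x) ^ 2) / b.energy f) f
  rw [← ENNReal.toReal_mul]
  refine (ENNReal.ofReal_le_iff_le_toReal (ENNReal.mul_ne_top hR hf)).1 ?_
  exact (ENNReal.div_le_iff_le_mul (Or.inr hR) (Or.inl hf)).1 h

theorem resistance_le {x y : X} {S : ℝ≥0∞}
    (H : ∀ f : X → ℝ, b.energy f ≠ ∞ → ENNReal.ofReal ((f y - f x) ^ 2) ≤ S * b.energy f) :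
    b.resistance x y ≤ S := by
  refine iSup_le fun f => ?_
  by_cases hf : b.energy f = ∞
  · simp [hf]
  · exact ENNReal.div_le_of_le_mul (H f hf)

theorem resistance_self (x : X) : b.resistance x x = 0 := by simp [resistance]

theorem resistance_comm (x y : X) : b.resistance x y = b.resistance y x := by
  unfold resistance
  congr 1
  ext f
  rw [show (f y - f x) ^ 2 = (f x - f y) ^ 2 by ring]

/-- Cut `f` at the level `f y`. If this level lies between `f x` and `f z`, the two truncations
carry the two increments and share the energy, so Cauchy–Schwarz applies. Otherwise one of the
increments from or to `y` already dominates `f z - f x`. -/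
theorem resistance_triangle (x y z : X) :
    b.resistance x z ≤ b.resistance x y + b.resistance y z := by
  by_cases h1 : b.resistance x y = ∞
  · simp [h1]
  by_cases h2 : b.resistance y z = ∞
  · simp [h2]
  refine b.resistance_le fun f hf => ?_
  rw [ENNReal.ofReal_le_iff_le_toReal (ENNReal.mul_ne_top (ENNReal.add_ne_top.2 ⟨h1, h2⟩) hf),
    ENNReal.toReal_mul, ENNReal.toReal_add h1 h2]
  set t := f y with ht
  have hs := b.energy_min_add_energy_max_le f t
  have hu : b.energy (fun a => min (f a) t) ≠ ∞ := ne_top_of_le_ne_top hf (le_self_add.trans hs)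
  have hv : b.energy (fun a => max (f a) t) ≠ ∞ := ne_top_of_le_ne_top hf (le_add_self.trans hs)
  have hs' := ENNReal.toReal_mono hf hs
  rw [ENNReal.toReal_add hu hv] at hs'
  have u1 := b.sq_le_toReal_mul h1 hu
  have u2 := b.sq_le_toReal_mul h2 hu
  have v1 := b.sq_le_toReal_mul h1 hv
  have v2 := b.sq_le_toReal_mul h2 hv
  have f1 := b.sq_le_toReal_mul h1 hf
  have f2 := b.sq_le_toReal_mul h2 hf
  have r1 : 0 ≤ (b.resistance x y).toReal := ENNReal.toReal_nonneg
  have r2 : 0 ≤ (b.resistance y z).toReal := ENNReal.toReal_nonneg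
  have A0 : 0 ≤ (b.energy (fun a => min (f a) t)).toReal := ENNReal.toReal_nonneg
  have B0 : 0 ≤ (b.energy (fun a => max (f a) t)).toReal := ENNReal.toReal_nonneg
  simp only [← ht, min_self, max_self] at u1 u2 v1 v2 f1 f2
  generalize (b.energy (fun a => min (f a) t)).toReal = A at *
  generalize (b.energy (fun a => max (f a) t)).toReal = B at *
  generalize (b.energy f).toReal = E at *
  generalize (b.resistance x y).toReal = r at *
  generalize (b.resistance y z).toReal = s at *
  have key : ∀ p q P Q : ℝ, 0 ≤ P → 0 ≤ Q → P + Q ≤ E → p ^ 2 ≤ r * P → q ^ 2 ≤ s * Q →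
      (p + q) ^ 2 ≤ (r + s) * E := by
    intro p q P Q hP hQ hPQ hp hq
    have h3 : 2 * (p * q) ≤ r * Q + s * P := by
      have h4 : (p * q) ^ 2 ≤ (r * Q) * (s * P) := by
        calc (p * q) ^ 2 = p ^ 2 * q ^ 2 := by ring
          _ ≤ (r * P) * (s * Q) := by gcongr
          _ = _ := by ring
      have h5 : (2 * (p * q)) ^ 2 ≤ (r * Q + s * P) ^ 2 := by
        nlinarith [sq_nonneg (r * Q - s * P)]
      exact le_of_sq_le_sq h5 (by positivity)
    nlinarith
  have E0 : 0 ≤ E := by linarith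
  rcases le_total (f x) t with hx | hx <;> rcases le_total (f z) t with hz | hz
  · rcases le_total (f x) (f z) with hxz | hxz
    · nlinarith [mul_nonneg r2 E0]
    · nlinarith [mul_nonneg r1 E0]
  · simp only [min_eq_left hx, max_eq_left hz] at u1 v2
    have := key _ _ _ _ A0 B0 hs' u1 v2
    nlinarith
  · simp only [min_eq_left hz, max_eq_left hx] at v1 u2
    have := key _ _ _ _ B0 A0 (by linarith) v1 u2
    nlinarith
  · rcases le_total (f x) (f z) with hxz | hxz
    · nlinarith [mul_nonneg r1 E0]
    · nlinarith [mul_nonneg r2 E0]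

theorem b_mul_sq_le_energy (f : X → ℝ) (x y : X) :
    (b.b x y : ℝ≥0∞) * ENNReal.ofReal ((f x - f y) ^ 2) ≤ b.energy f := by
  set F : X → X → ℝ≥0∞ := fun x y => (b.b x y : ℝ≥0∞) * ENNReal.ofReal ((f x - f y) ^ 2) with hF
  have hsymm : F y x = F x y := by
    simp only [hF, b.symm y x, show (f y - f x) ^ 2 = (f x - f y) ^ 2 by ring]
  change F x y ≤ 2⁻¹ * ∑' x, ∑' y, F x y
  rcases eq_or_ne x y with rfl | hxy
  · simp [hF]
  -- Each edge is counted in both orientations, which compensates the factor `2⁻¹`.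
  have : F x y + F y x ≤ ∑' x, ∑' y, F x y := by
    classical
    calc F x y + F y x ≤ ∑' b, F x b + ∑' b, F y b := add_le_add (ENNReal.le_tsum _) (ENNReal.le_tsum _)
      _ = ∑ a ∈ {x, y}, ∑' b, F a b := by rw [Finset.sum_pair hxy]
      _ ≤ _ := ENNReal.sum_le_tsum _
  rw [hsymm, ← two_mul] at this
  calc F x y = 2⁻¹ * (2 * F x y) := by
        rw [← mul_assoc, ENNReal.inv_mul_cancel (by norm_num) (by norm_num), one_mul]
    _ ≤ _ := by gcongr

theorem resistance_ne_top_of_adj {x y : X} (h : b.toSimpleGraph.Adj x y) :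
    b.resistance x y ≠ ∞ := by
  have hb : (b.b x y : ℝ≥0∞) ≠ 0 := by
    have : 0 < b.b x y := h
    exact_mod_cast this.ne'
  refine ne_top_of_le_ne_top (ENNReal.inv_ne_top.2 hb) (b.resistance_le fun f _ => ?_)
  calc ENNReal.ofReal ((f y - f x) ^ 2)
      = (b.b x y : ℝ≥0∞)⁻¹ * ((b.b x y : ℝ≥0∞) * ENNReal.ofReal ((f x - f y) ^ 2)) := by
        rw [← mul_assoc, ENNReal.inv_mul_cancel hb (by simp), one_mul,
          show (f y - f x) ^ 2 = (f x - f y) ^ 2 by ring]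
    _ ≤ _ := by gcongr; exact b.b_mul_sq_le_energy f x y

theorem resistance_ne_top {x y : X} (h : b.toSimpleGraph.Reachable x y) :
    b.resistance x y ≠ ∞ := by
  obtain ⟨p⟩ := h
  induction p with
  | nil => simp [resistance_self]
  | cons h p ih =>
    exact ne_top_of_le_ne_top (ENNReal.add_ne_top.2 ⟨b.resistance_ne_top_of_adj h, ih⟩)
      (b.resistance_triangle _ _ _)

theorem reachable_of_resistance_ne_top {x y : X} (h : b.resistance x y ≠ ∞) :
    b.toSimpleGraph.Reachable x y := by
  classical
  by_contra hxy
  set f : X → ℝ := fun a => if b.toSimpleGraph.Reachable x a then 1 else 0 with hf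
  have hE : b.energy f = 0 := by
    -- Both coefficients are `0`: the indicator of a component is constant along every edge.
    have := b.energy_le_add (f := f) (g := f) (h := f) le_rfl le_rfl (fun a c hac => by
      have hac' : b.toSimpleGraph.Adj a c := hac
      have : b.toSimpleGraph.Reachable x a ↔ b.toSimpleGraph.Reachable x c :=
        ⟨fun h => h.trans hac'.reachable, fun h => h.trans hac'.symm.reachable⟩
      simp [hf, this])
    simpa using this
  have := b.sq_le_toReal_mul h (f := f) (by simp [hE])
  rw [hE] at this
  simp only [hf, hxy, SimpleGraph.Reachable.refl, if_true, if_false] at this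
  norm_num at this

/-! ### Changing a function at one vertex -/

section Row

/-- The part of the energy carried by the edges at `p`, when `p` is assigned the value `s`. -/
noncomputable def rowEnergy (f : X → ℝ) (p : X) (s : ℝ) : ℝ≥0∞ :=
  ∑' q, (b.b p q : ℝ≥0∞) * ENNReal.ofReal ((s - f q) ^ 2)

open Classical in
-- Only the edges at `p` see `s`. They occur once as a row and once as a column of the double sum,
-- so the factor `2⁻¹` disappears.
theorem energy_update (f : X → ℝ) (p : X) :
    ∃ C : ℝ≥0∞, ∀ s, b.energy (Function.update f p s) = b.rowEnergy f p s + C := by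
  refine ⟨2⁻¹ * ∑' x, if x = p then 0 else ∑' y, if y = p then 0 else
    (b.b x y : ℝ≥0∞) * ENNReal.ofReal ((f x - f y) ^ 2), fun s => ?_⟩
  set g := Function.update f p s with hg
  have hgp : g p = s := by simp [hg]
  have hgne : ∀ x, x ≠ p → g x = f x := fun x hx => by simp [hg, hx]
  have hrow : ∑' y, (b.b p y : ℝ≥0∞) * ENNReal.ofReal ((g p - g y) ^ 2) = b.rowEnergy f p s := by
    unfold rowEnergy
    congr 1
    ext y
    rcases eq_or_ne y p with rfl | hy
    · simp [b.diag]
    · rw [hgp, hgne y hy]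
  have hcol : ∑' x, (if x = p then 0 else
      (b.b x p : ℝ≥0∞) * ENNReal.ofReal ((g x - g p) ^ 2)) = b.rowEnergy f p s := by
    rw [← hrow]
    congr 1
    ext y
    split_ifs with h
    · simp [h, b.diag]
    · rw [b.symm y p, show (g y - g p) ^ 2 = (g p - g y) ^ 2 by ring]
  have hsplit : ∀ x, (if x = p then 0 else
      ∑' y, (b.b x y : ℝ≥0∞) * ENNReal.ofReal ((g x - g y) ^ 2)) =
      (if x = p then 0 else (b.b x p : ℝ≥0∞) * ENNReal.ofReal ((g x - g p) ^ 2)) +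
      (if x = p then 0 else ∑' y, if y = p then 0 else
        (b.b x y : ℝ≥0∞) * ENNReal.ofReal ((f x - f y) ^ 2)) := by
    intro x
    split_ifs with hx
    · simp
    · rw [ENNReal.tsum_eq_add_tsum_ite p]
      congr 2
      ext y
      split_ifs with hy
      · rfl
      · rw [hgne x hx, hgne y hy]
  unfold energy
  rw [ENNReal.tsum_eq_add_tsum_ite p, hrow]
  simp_rw [hsplit]
  rw [ENNReal.tsum_add, hcol, ← add_assoc, ← two_mul, mul_add, ← mul_assoc,
    ENNReal.inv_mul_cancel (by norm_num) (by norm_num), one_mul]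

open Classical in
theorem energy_indicator_ne_top (p : X) :
    b.energy (Function.update 0 p 1) ≠ ∞ := by
  obtain ⟨C, hC⟩ := b.energy_update 0 p
  have hC0 : C = 0 := by
    have h0 := hC 0
    rw [Function.update_eq_self_iff.2 (by rfl)] at h0
    have hE : b.energy 0 = 0 := by simp [energy]
    rw [hE] at h0
    exact (add_eq_zero.1 h0.symm).2
  rw [hC, hC0, add_zero]
  have h1 : b.rowEnergy 0 p 1 = ∑' q, (b.b p q : ℝ≥0∞) := by simp [rowEnergy]
  rw [h1, ENNReal.tsum_coe_ne_top_iff_summable]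
  exact b.summable p

theorem resistance_ne_zero {x y : X} (h : x ≠ y) : b.resistance x y ≠ 0 := by
  classical
  intro h0
  have := b.sq_le_toReal_mul (h0 ▸ ENNReal.zero_ne_top) (b.energy_indicator_ne_top x)
  rw [h0, Function.update_self, Function.update_of_ne h.symm] at this
  norm_num at this

theorem rowEnergy_eq_sum (hb : b.LocallyFinite) (f : X → ℝ) (p : X) (s : ℝ) :
    b.rowEnergy f p s =
      ENNReal.ofReal (∑ q ∈ (hb p).toFinset, (b.b p q : ℝ) * (s - f q) ^ 2) := by
  rw [ENNReal.ofReal_sum_of_nonneg (fun q _ => by positivity), rowEnergy,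
    tsum_eq_sum (s := (hb p).toFinset)]
  · refine Finset.sum_congr rfl fun q _ => ?_
    rw [ENNReal.ofReal_mul (by positivity), ENNReal.ofReal_coe_nnreal]
  · intro q hq
    have : b.b p q = 0 := by simpa using hq
    simp [this]

open Classical in
/-- If `f` attains its maximum at `p` and is smaller at some neighbour of `p`, then its energy can
be decreased by changing its value at `p` only. -/
theorem exists_energy_update_lt (hb : b.LocallyFinite) {f : X → ℝ}
    (hf : b.energy f ≠ ∞) {p q : X} (hmax : ∀ a, f a ≤ f p) (hpq : b.toSimpleGraph.Adj p q)
    (hq : f q < f p) : ∃ s, b.energy (Function.update f p s) < b.energy f := by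
  obtain ⟨C, hC⟩ := b.energy_update f p
  have hself := hC (f p)
  rw [Function.update_eq_self] at hself
  have hCtop : C ≠ ∞ := ne_top_of_le_ne_top hf (hself ▸ le_add_self)
  set F := (hb p).toFinset with hF
  set c := ∑ a ∈ F, (b.b p a : ℝ) * (f p - f a) with hc
  set d := ∑ a ∈ F, (b.b p a : ℝ) with hd
  have hqF : q ∈ F := (Set.Finite.mem_toFinset _).2 hpq
  have hbq : (0 : ℝ) < b.b p q := by exact_mod_cast hpq
  have hcpos : 0 < c := Finset.sum_pos' (fun a _ => mul_nonneg (b.b p a).2 (by linarith [hmax a]))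
    ⟨q, hqF, mul_pos hbq (by linarith)⟩
  have hdpos : 0 < d := Finset.sum_pos' (fun a _ => (b.b p a).2) ⟨q, hqF, hbq⟩
  -- This is the `b`-weighted mean of `f` over the neighbours of `p`, the minimiser of the quadratic
  -- row energy; the gain is `c ^ 2 / d`.
  refine ⟨f p - c / d, ?_⟩
  rw [hC, hself]
  refine ENNReal.add_lt_add_right hCtop ?_
  rw [b.rowEnergy_eq_sum hb, b.rowEnergy_eq_sum hb, ENNReal.ofReal_lt_ofReal_iff_of_nonneg
    (Finset.sum_nonneg fun a _ => by positivity)]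
  have expand : ∑ a ∈ F, (b.b p a : ℝ) * (f p - c / d - f a) ^ 2 =
      ∑ a ∈ F, (b.b p a : ℝ) * (f p - f a) ^ 2 - 2 * (c / d) * c + (c / d) ^ 2 * d := by
    rw [hc, hd, Finset.mul_sum, Finset.mul_sum, ← Finset.sum_sub_distrib, ← Finset.sum_add_distrib]
    exact Finset.sum_congr rfl fun a _ => by ring
  rw [expand]
  have : (c / d) ^ 2 * d = (c / d) * c := by field_simp
  nlinarith [mul_pos (div_pos hcpos hdpos) hcpos]

end Row

end WGraph

/-! ### Sharpness of the triangle inequality and separating vertices -/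

namespace WGraph

variable {X : Type*} (b : WGraph X)

/-- Resistances add up at a vertex separating `x` from `z`. -/
theorem resistance_add_le_of_separates {x y z : X}
    (hsep : ∀ q : b.toSimpleGraph.Walk x z, y ∈ q.support) :
    b.resistance x y + b.resistance y z ≤ b.resistance x z := by
  classical
  by_cases hR : b.resistance x z = ∞
  · simp [hR]
  rcases eq_or_ne x y with rfl | hxy
  · simp [resistance_self]
  -- `C` is the component of `x` after deleting `y`; an edge can leave it only into `y`.
  set C : Set X := {a | ∃ q : b.toSimpleGraph.Walk x a, y ∉ q.support} with hCdef
  have hxC : x ∈ C := ⟨SimpleGraph.Walk.nil, by simpa using hxy.symm⟩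
  have hzC : z ∉ C := fun ⟨q, hq⟩ => hq (hsep q)
  have hstep : ∀ a c, a ∈ C → c ∉ C → b.toSimpleGraph.Adj a c → c = y := by
    rintro a c ⟨q, hq⟩ hc hac
    by_contra hcy
    exact hc ⟨q.concat hac, by simp [SimpleGraph.Walk.support_concat, hq, Ne.symm hcy]⟩
  refine ENNReal.iSup_add_iSup_le fun f g => ?_
  -- Both pieces are shifted to vanish at `y`, so an edge leaving `C` sees only the increment of
  -- `f`.
  have glue : ∀ α β : ℝ, b.energy (fun a => if a ∈ C then α * (f a - f y) else β * (g a - g y)) ≤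
      ENNReal.ofReal (α ^ 2) * b.energy f + ENNReal.ofReal (β ^ 2) * b.energy g := by
    intro α β
    refine b.energy_le_add (sq_nonneg _) (sq_nonneg _) fun a c hac => ?_
    by_cases ha : a ∈ C <;> by_cases hc : c ∈ C <;> simp only [ha, hc, if_true, if_false]
    · nlinarith [mul_nonneg (sq_nonneg β) (sq_nonneg (g a - g c))]
    · obtain rfl := hstep a c ha hc hac
      nlinarith [mul_nonneg (sq_nonneg β) (sq_nonneg (g a - g c))]
    · obtain rfl := hstep c a hc ha (SimpleGraph.Adj.symm hac)
      nlinarith [mul_nonneg (sq_nonneg β) (sq_nonneg (g a - g c))]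
    · nlinarith [mul_nonneg (sq_nonneg α) (sq_nonneg (f a - f c))]
  have hxyR : b.toSimpleGraph.Reachable x y := by
    obtain ⟨q⟩ := b.reachable_of_resistance_ne_top hR
    exact ⟨q.takeUntil y (hsep q)⟩
  have hyzR : b.toSimpleGraph.Reachable y z :=
    hxyR.symm.trans (b.reachable_of_resistance_ne_top hR)
  have hf : ENNReal.ofReal ((f y - f x) ^ 2) / b.energy f ≠ ∞ :=
    ne_top_of_le_ne_top (b.resistance_ne_top hxyR)
      (le_iSup (fun f : X → ℝ => ENNReal.ofReal ((f y - f x) ^ 2) / b.energy f) f)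
  have hg : ENNReal.ofReal ((g z - g y) ^ 2) / b.energy g ≠ ∞ :=
    ne_top_of_le_ne_top (b.resistance_ne_top hyzR)
      (le_iSup (fun f : X → ℝ => ENNReal.ofReal ((f z - f y) ^ 2) / b.energy f) g)
  rw [← ENNReal.toReal_le_toReal (ENNReal.add_ne_top.2 ⟨hf, hg⟩) hR, ENNReal.toReal_add hf hg,
    ENNReal.toReal_div, ENNReal.toReal_div, ENNReal.toReal_ofReal (sq_nonneg _),
    ENNReal.toReal_ofReal (sq_nonneg _)]
  set A := (b.energy f).toReal with hA
  set B := (b.energy g).toReal with hB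
  have scaled : ∀ (h : X → ℝ) (δ : ℝ), ENNReal.ofReal ((δ / (b.energy h).toReal) ^ 2) *
      b.energy h = ENNReal.ofReal (δ ^ 2 / (b.energy h).toReal) := by
    intro h δ
    by_cases ht : b.energy h = ∞
    · simp [ht]
    · conv_lhs => rw [← ENNReal.ofReal_toReal ht]
      rw [ENNReal.toReal_ofReal ENNReal.toReal_nonneg, ← ENNReal.ofReal_mul (sq_nonneg _)]
      congr 1
      rcases eq_or_ne (b.energy h).toReal 0 with h0 | h0
      · simp [h0]
      · field_simp
  -- With these factors each piece has increment and energy both equal to its quotient. For the sum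
  -- `S` of the two quotients this gives `S ^ 2 ≤ R(x,z) * S`. Infinite energy is harmless, since
  -- `toReal` then makes the factor `0`.
  have h1 := glue ((f y - f x) / A) ((g z - g y) / B)
  rw [scaled, scaled, ← hA, ← hB] at h1
  have hA0 : 0 ≤ (f y - f x) ^ 2 / A := div_nonneg (sq_nonneg _) ENNReal.toReal_nonneg
  have hB0 : 0 ≤ (g z - g y) ^ 2 / B := div_nonneg (sq_nonneg _) ENNReal.toReal_nonneg
  rw [← ENNReal.ofReal_add hA0 hB0] at h1
  have h2 := b.sq_le_toReal_mul hR (ne_top_of_le_ne_top ENNReal.ofReal_ne_top h1)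
  have h3 := ENNReal.toReal_le_of_le_ofReal (add_nonneg hA0 hB0) h1
  simp only [hxC, hzC, if_true, if_false] at h2
  have h4 : ((g z - g y) / B * (g z - g y) - (f y - f x) / A * (f x - f y)) =
      (f y - f x) ^ 2 / A + (g z - g y) ^ 2 / B := by ring
  rw [h4] at h2
  have h5 : ((f y - f x) ^ 2 / A + (g z - g y) ^ 2 / B) ^ 2 ≤
      (b.resistance x z).toReal * ((f y - f x) ^ 2 / A + (g z - g y) ^ 2 / B) :=
    h2.trans (mul_le_mul_of_nonneg_left h3 ENNReal.toReal_nonneg)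
  rcases (add_nonneg hA0 hB0).eq_or_lt with h0 | h0
  · rw [← h0]; exact ENNReal.toReal_nonneg
  · rw [sq] at h5
    exact le_of_mul_le_mul_right h5 h0

theorem lowerSemicontinuous_energy : LowerSemicontinuous b.energy := by
  have : LowerSemicontinuous fun f : X → ℝ =>
      ∑' x, ∑' y, (2⁻¹ : ℝ≥0∞) * ((b.b x y : ℝ≥0∞) * ENNReal.ofReal ((f x - f y) ^ 2)) := by
    refine lowerSemicontinuous_tsum fun x => lowerSemicontinuous_tsum fun y => ?_
    refine Continuous.lowerSemicontinuous ?_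
    refine ENNReal.continuous_const_mul (by simp) |>.comp
      (ENNReal.continuous_const_mul ENNReal.coe_ne_top |>.comp ?_)
    exact ENNReal.continuous_ofReal.comp (by fun_prop)
  convert this using 2 with f
  simp_rw [energy, ENNReal.tsum_mul_left]

/-- The supremum defining the resistance is attained. -/
theorem exists_energy_mul_resistance_le_one {x z : X} (hxz : x ≠ z)
    (hR : b.resistance x z ≠ ∞) :
    ∃ f : X → ℝ, f x = 0 ∧ f z = 1 ∧ b.energy f ≠ ∞ ∧ (∀ a, 0 ≤ f a ∧ f a ≤ 1) ∧
      (b.energy f).toReal * (b.resistance x z).toReal ≤ 1 := by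
  classical
  -- Tychonoff makes `K` compact in the product topology, where the energy is lower semicontinuous.
  set K : Set (X → ℝ) := Set.univ.pi (fun _ => Set.Icc 0 1) ∩ {f | f x = 0 ∧ f z = 1} with hK
  have hKc : IsCompact K := by
    refine (isCompact_univ_pi fun _ => isCompact_Icc).inter_right ?_
    exact (isClosed_eq (continuous_apply x) continuous_const).inter
      (isClosed_eq (continuous_apply z) continuous_const)
  have hmem : Function.update (0 : X → ℝ) z 1 ∈ K := by
    refine ⟨fun a _ => ?_, by simp [hxz], by simp⟩
    rcases eq_or_ne a z with rfl | h
    · simp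
    · simp [h]
  obtain ⟨f, ⟨hf01, hfx, hfz⟩, hmin⟩ :=
    (b.lowerSemicontinuous_energy.lowerSemicontinuousOn K).exists_isMinOn ⟨_, hmem⟩ hKc
  have hftop : b.energy f ≠ ∞ := ne_top_of_le_ne_top (b.energy_indicator_ne_top z) (hmin hmem)
  refine ⟨f, hfx, hfz, hftop, fun a => hf01 a trivial, ?_⟩
  have hle := b.sq_le_toReal_mul hR hftop
  rw [hfx, hfz] at hle
  have hE0 : b.energy f ≠ 0 := by
    intro h0
    rw [h0] at hle
    norm_num at hle
  have hinv : b.resistance x z ≤ (b.energy f)⁻¹ := by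
    refine b.resistance_le fun g hg => ?_
    rcases eq_or_ne (g z) (g x) with heq | hne
    · simp [heq]
    have hd : g z - g x ≠ 0 := sub_ne_zero.2 hne
    -- Normalising and clamping to `[0, 1]` brings any competitor into `K`; clamping is a
    -- contraction and cannot raise the energy.
    set h : X → ℝ := fun a => max 0 (min 1 ((g a - g x) / (g z - g x))) with hh
    have hhK : h ∈ K := by
      refine ⟨fun a _ => ⟨le_max_left _ _, max_le zero_le_one (min_le_left _ _)⟩, ?_, ?_⟩
      · simp [hh]
      · simp [hh, div_self hd]
    have h1 : b.energy h ≤ ENNReal.ofReal (((g z - g x) ^ 2)⁻¹) * b.energy g := by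
      refine b.energy_le_mul (by positivity) fun a c => ?_
      have habs : |h a - h c| ≤ |(g a - g x) / (g z - g x) - (g c - g x) / (g z - g x)| :=
        (abs_max_sub_max_le_max _ _ _ _).trans (max_le (by simp)
          ((abs_min_sub_min_le_max _ _ _ _).trans (max_le (by simp) le_rfl)))
      calc (h a - h c) ^ 2
          ≤ ((g a - g x) / (g z - g x) - (g c - g x) / (g z - g x)) ^ 2 := sq_le_sq.2 habs
        _ = _ := by field_simp; ring
    have h2 : b.energy f ≤ ENNReal.ofReal (((g z - g x) ^ 2)⁻¹) * b.energy g := (hmin hhK).trans h1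
    have hpos : 0 < (g z - g x) ^ 2 := by positivity
    calc ENNReal.ofReal ((g z - g x) ^ 2)
        = (b.energy f)⁻¹ * (ENNReal.ofReal ((g z - g x) ^ 2) * b.energy f) := by
          rw [mul_left_comm, ENNReal.inv_mul_cancel hE0 hftop, mul_one]
      _ ≤ (b.energy f)⁻¹ * (ENNReal.ofReal ((g z - g x) ^ 2) *
            (ENNReal.ofReal (((g z - g x) ^ 2)⁻¹) * b.energy g)) := by gcongr
      _ = _ := by
          rw [← mul_assoc (ENNReal.ofReal _), ← ENNReal.ofReal_mul hpos.le,
            mul_inv_cancel₀ hpos.ne', ENNReal.ofReal_one, one_mul]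
  have h3 : b.energy f * b.resistance x z ≤ 1 := by
    calc b.energy f * b.resistance x z ≤ b.energy f * (b.energy f)⁻¹ := by gcongr
      _ = 1 := ENNReal.mul_inv_cancel hE0 hftop
  rw [← ENNReal.toReal_mul]
  simpa using ENNReal.toReal_mono ENNReal.one_ne_top h3

/-- Equality in the triangle inequality forces `y` to separate `x` from `z`. -/
theorem mem_support_of_resistance_add_le (hb : b.LocallyFinite) {x y z : X}
    (hR : b.resistance x z ≠ ∞)
    (hadd : b.resistance x y + b.resistance y z ≤ b.resistance x z)
    (q : b.toSimpleGraph.Walk x z) : y ∈ q.support := by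
  classical
  rcases eq_or_ne x y with rfl | hxy
  · exact q.start_mem_support
  rcases eq_or_ne x z with rfl | hxz
  · rw [b.resistance_self] at hadd
    exact absurd (add_eq_zero.1 (le_zero_iff.1 hadd)).1 (b.resistance_ne_zero hxy)
  by_contra hyq
  obtain ⟨f, hfx, hfz, hftop, hf01, hopt⟩ := b.exists_energy_mul_resistance_le_one hxz hR
  have hR1 : b.resistance x y ≠ ∞ := ne_top_of_le_ne_top hR (le_self_add.trans hadd)
  have hR2 : b.resistance y z ≠ ∞ := ne_top_of_le_ne_top hR (le_add_self.trans hadd)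
  have hadd' := ENNReal.toReal_mono hR hadd
  rw [ENNReal.toReal_add hR1 hR2] at hadd'
  have hr1 : 0 < (b.resistance x y).toReal :=
    ENNReal.toReal_pos (b.resistance_ne_zero hxy) hR1
  have hr2 : 0 ≤ (b.resistance y z).toReal := ENNReal.toReal_nonneg
  obtain ⟨t, ht⟩ : ∃ t, f y = t := ⟨_, rfl⟩
  have hs := b.energy_min_add_energy_max_le f t
  set u : X → ℝ := fun a => min (f a) t with hu
  set v : X → ℝ := fun a => max (f a) t with hv
  have hutop : b.energy u ≠ ∞ := ne_top_of_le_ne_top hftop (le_self_add.trans hs)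
  have hvtop : b.energy v ≠ ∞ := ne_top_of_le_ne_top hftop (le_add_self.trans hs)
  have hs' := ENNReal.toReal_mono hftop hs
  rw [ENNReal.toReal_add hutop hvtop] at hs'
  have ht0 : 0 ≤ t := ht ▸ (hf01 y).1
  have ht1 : t ≤ 1 := ht ▸ (hf01 y).2
  have hux : u x = 0 := by simp [hu, hfx, ht0]
  have huy : u y = t := by simp [hu, ht]
  have huz : u z = t := by simp [hu, hfz, ht1]
  have hvy : v y = t := by simp [hv, ht]
  have hvz : v z = 1 := by simp [hv, hfz, ht1]
  have hV := b.sq_le_toReal_mul hR2 hvtop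
  rw [hvy, hvz] at hV
  have E0 : 0 ≤ (b.energy f).toReal := ENNReal.toReal_nonneg
  -- `u` minimises the energy among functions with its values at `x` and `y`
  have hminU : ∀ u' : X → ℝ, u' x = 0 → u' y = t → ¬ b.energy u' < b.energy u := by
    intro u' hx' hy' hlt
    have hU := b.sq_le_toReal_mul hR1 hlt.ne_top
    rw [hx', hy', sub_zero] at hU
    have hlt' := (ENNReal.toReal_lt_toReal hlt.ne_top hutop).2 hlt
    have hA' : 0 ≤ (b.energy u').toReal := ENNReal.toReal_nonneg
    have hB : 0 ≤ (b.energy v).toReal := ENNReal.toReal_nonneg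
    generalize (b.energy u').toReal = A' at *
    generalize (b.energy u).toReal = A at *
    generalize (b.energy v).toReal = B at *
    generalize (b.energy f).toReal = E at *
    generalize (b.resistance x y).toReal = r at *
    generalize (b.resistance y z).toReal = s at *
    have h1 : E * (r + s) ≤ 1 := (mul_le_mul_of_nonneg_left hadd' E0).trans hopt
    have h2 : (A' + B) * (r + s) < 1 := by nlinarith
    -- The Cauchy–Schwarz step of the triangle inequality: it yields `1 = (t + (1 - t)) ^ 2 ≤ (r +
    -- s) * (A' + B)`, against `h2`.
    have h3 : 2 * (t * (1 - t)) ≤ r * B + s * A' := by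
      have h4 : (t * (1 - t)) ^ 2 ≤ (r * B) * (s * A') := by
        calc (t * (1 - t)) ^ 2 = t ^ 2 * (1 - t) ^ 2 := by ring
          _ ≤ (r * A') * (s * B) := by gcongr
          _ = _ := by ring
      have h5 : (2 * (t * (1 - t))) ^ 2 ≤ (r * B + s * A') ^ 2 := by
        nlinarith [sq_nonneg (r * B - s * A')]
      exact le_of_sq_le_sq h5 (by positivity)
    nlinarith
  -- If `t = 0`, then `v` alone gives `1 ≤ R(y,z) * Q(v)`, while optimality gives `(R(x,y) + R(y,z))
  -- * Q(v) ≤ 1` with `R(x,y) > 0`.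
  have htpos : 0 < t := by
    refine ht0.lt_of_ne fun h0 => ?_
    have h1 : 1 ≤ (b.resistance y z).toReal * (b.energy v).toReal := by
      simpa [← h0] using hV
    have hA : 0 ≤ (b.energy u).toReal := ENNReal.toReal_nonneg
    have hB : 0 ≤ (b.energy v).toReal := ENNReal.toReal_nonneg
    have hBpos : 0 < (b.energy v).toReal := by
      refine hB.lt_of_ne fun h => ?_
      rw [← h] at h1
      norm_num at h1
    nlinarith [mul_le_mul_of_nonneg_left hadd' E0]
  have hmaxu : ∀ a, u a ≤ t := fun a => min_le_right _ _
  -- Maximum principle: at a vertex other than `x, y` where `u` is maximal, a smaller neighbour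
  -- would allow the energy to be lowered there, keeping the values at `x` and `y`.
  have spread : ∀ {a c : X} (p : b.toSimpleGraph.Walk a c), y ∉ p.support → u c = t → u a = t := by
    intro a c p
    induction p with
    | nil => exact fun _ h => h
    | cons hac p ih =>
      rename_i a c d
      intro hyp hd
      rw [SimpleGraph.Walk.support_cons, List.mem_cons, not_or] at hyp
      have hc := ih hyp.2 hd
      by_contra hne
      have hcx : c ≠ x := by
        rintro rfl
        exact htpos.ne' (hc.symm.trans hux)
      have hcy : c ≠ y := by
        rintro rfl
        exact hyp.2 p.start_mem_support
      obtain ⟨s, hs⟩ := b.exists_energy_update_lt hb hutop (p := c) (q := a)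
        (fun e => hc ▸ hmaxu e) hac.symm (hc ▸ lt_of_le_of_ne (hmaxu a) hne)
      exact hminU _ (by rw [Function.update_of_ne hcx.symm, hux])
        (by rw [Function.update_of_ne hcy.symm, huy]) hs
  have := spread q hyq huz
  rw [hux] at this
  exact htpos.ne this

end WGraph

/-! ### Path metrics -/

section PathMetric

variable {X : Type*} {w : X → X → ℝ≥0∞}

theorem pathMetric_le {n : ℕ} {γ : Fin (n + 1) → X} (hγ : Function.Injective γ) :
    pathMetric w (γ 0) (γ (Fin.last n)) ≤ ∑ i : Fin n, w (γ i.castSucc) (γ i.succ) :=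
  iInf_le_of_le n <| iInf_le_of_le γ <| iInf_le_of_le hγ <| iInf_le_of_le rfl <|
    iInf_le_of_le rfl le_rfl

theorem pathMetric_le_weight {x y : X} (hxy : x ≠ y) : pathMetric w x y ≤ w x y := by
  have : Function.Injective ![x, y] := by
    intro i j
    fin_cases i <;> fin_cases j <;> simp [hxy, hxy.symm]
  simpa using pathMetric_le (w := w) this

theorem le_pathMetric {x y : X} {c : ℝ≥0∞}
    (H : ∀ (n : ℕ) (γ : Fin (n + 1) → X), Function.Injective γ → γ 0 = x → γ (Fin.last n) = y →
      c ≤ ∑ i : Fin n, w (γ i.castSucc) (γ i.succ)) : c ≤ pathMetric w x y :=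
  le_iInf fun n => le_iInf fun γ => le_iInf fun h => le_iInf fun h0 => le_iInf fun h1 =>
    H n γ h h0 h1

theorem SimpleGraph.Walk.IsPath.pathMetric_le {G : SimpleGraph X} {x y : X} {p : G.Walk x y}
    (hp : p.IsPath) :
    pathMetric w x y ≤ ∑ i : Fin p.length, w (p.getVert i) (p.getVert (i + 1)) := by
  have hinj : Function.Injective fun i : Fin (p.length + 1) => p.getVert i := fun i j hij =>
    Fin.ext (hp.getVert_injOn (Nat.lt_succ_iff.1 i.2) (Nat.lt_succ_iff.1 j.2) hij)
  simpa using _root_.pathMetric_le (w := w) hinj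

end PathMetric

/-! ### The two implications -/

namespace WGraph

variable {X : Type*} (b : WGraph X)

theorem resistance_le_sum {n : ℕ} (γ : Fin (n + 1) → X) :
    b.resistance (γ 0) (γ (Fin.last n)) ≤
      ∑ i : Fin n, b.resistance (γ i.castSucc) (γ i.succ) := by
  induction n with
  | zero => simp [b.resistance_self]
  | succ n ih =>
    rw [Fin.sum_univ_succ]
    refine (b.resistance_triangle _ (γ (Fin.succ 0)) _).trans ?_
    gcongr
    · simp
    · simpa using ih (fun i => γ i.succ)

/-- Resistances add up along unique induced paths. -/
theorem sum_resistance_le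
    (huniq : ∀ (x y : X) (p q : b.toSimpleGraph.Walk x y), p.IsInducedPath → q.IsInducedPath →
      p = q) {x y : X} {p : b.toSimpleGraph.Walk x y} (hp : p.IsInducedPath) :
    ∑ i : Fin p.length, b.resistance (p.getVert i) (p.getVert (i + 1)) ≤ b.resistance x y := by
  induction p with
  | nil => exact (Finset.sum_of_isEmpty (ι := Fin 0) _).trans_le zero_le
  | cons h p ih =>
    refine le_trans ?_ (b.resistance_add_le_of_separates
      (SimpleGraph.Walk.snd_mem_support_of_unique fun q hq => huniq _ _ q _ hq hp))
    refine (Fin.sum_univ_succ (n := p.length) _).trans_le ?_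
    gcongr
    · simp
    · simpa using ih hp.of_cons

theorem exists_weight_of_isComponentwiseBlockGraph (h : b.IsComponentwiseBlockGraph) :
    ∃ w : X → X → ℝ≥0∞, IsWeight w ∧ b.Compatible w ∧ b.resistance = pathMetric w := by
  classical
  set w : X → X → ℝ≥0∞ := fun x y => if x ≠ y ∧ b.b x y = 0 then ∞ else b.resistance x y with hw
  have hle : ∀ x y, b.resistance x y ≤ w x y := by
    intro x y
    simp only [hw]
    split_ifs
    · exact le_top
    · exact le_rfl
  have hadj : ∀ x y, b.toSimpleGraph.Adj x y → w x y = b.resistance x y := by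
    intro x y hxy
    have : 0 < b.b x y := hxy
    simp [hw, this.ne']
  refine ⟨w, ⟨fun x y => ?_, fun x y => ⟨fun h0 => ?_, ?_⟩⟩, fun x y h0 hne => by simp [hw, h0, hne],
    ?_⟩
  · simp only [hw, ne_comm (a := x), b.symm x y, b.resistance_comm x y]
  · by_contra hne
    exact b.resistance_ne_zero hne (le_zero_iff.1 (h0 ▸ hle x y))
  · rintro rfl
    simp [hw, b.resistance_self]
  · ext x y
    -- One bound is the triangle inequality along any sequence; the other uses the induced path,
    -- along which `R` is additive.
    refine le_antisymm (le_pathMetric ?_) ?_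
    · rintro n γ - rfl rfl
      exact (b.resistance_le_sum γ).trans (Finset.sum_le_sum fun i _ => hle _ _)
    · by_cases hR : b.resistance x y = ∞
      · simp [hR]
      obtain ⟨p, hp, -⟩ := h x y (b.reachable_of_resistance_ne_top hR)
      refine hp.1.pathMetric_le.trans ?_
      rw [Finset.sum_congr rfl fun i _ => hadj _ _ (p.adj_getVert_succ i.2)]
      exact b.sum_resistance_le (fun x y p q hp hq => (h x y ⟨p⟩).unique hp hq) hp

/-- If the resistance is a path metric, then some neighbour `y` of `x` lies on a geodesic from `x`
to `z`. -/
theorem exists_adj_resistance_add_le (hb : b.LocallyFinite) {w : X → X → ℝ≥0∞}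
    (hcomp : b.Compatible w) (hw : b.resistance = pathMetric w) {x z : X} (hxz : x ≠ z)
    (hR : b.resistance x z ≠ ∞) :
    ∃ y, b.toSimpleGraph.Adj x y ∧ b.resistance x y + b.resistance y z ≤ b.resistance x z := by
  set F := (hb x).toFinset with hF
  -- A sequence from `x` either starts with a non-edge and costs `∞`, or passes first to a
  -- neighbour, and its tail is again injective. As `F` is finite, the infimum is attained.
  have hlow : F.inf (fun y => b.resistance x y + b.resistance y z) ≤ b.resistance x z := by
    conv_rhs => rw [hw]
    refine le_pathMetric ?_
    rintro n γ hγ rfl rfl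
    cases n with
    | zero => exact absurd rfl hxz
    | succ n =>
      rw [Fin.sum_univ_succ]
      have hne : γ 0 ≠ γ 1 := hγ.ne (by simp)
      rcases eq_or_lt_of_le (zero_le (a := b.b (γ 0) (γ 1))) with h0 | h0
      · have := hcomp _ _ h0.symm hne
        simp [this]
      · refine (Finset.inf_le (f := fun y => b.resistance (γ 0) y + b.resistance y _)
          ((Set.Finite.mem_toFinset (hb (γ 0))).2 h0)).trans ?_
        rw [hw]
        gcongr
        · simpa using pathMetric_le_weight (w := w) hne
        · have := pathMetric_le (w := w) (γ := fun i => γ i.succ)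
            (hγ.comp (Fin.succ_injective _))
          simpa using this
  -- The infimum over the empty set is `∞`, which the finiteness of `R(x,z)` excludes.
  have hne : F.Nonempty := by
    rw [Finset.nonempty_iff_ne_empty]
    intro h
    rw [h, Finset.inf_empty] at hlow
    exact hR (top_le_iff.1 hlow)
  obtain ⟨y, hy, hyinf⟩ := Finset.exists_mem_eq_inf F hne
    (fun y => b.resistance x y + b.resistance y z)
  exact ⟨y, (Set.Finite.mem_toFinset (hb x)).1 hy, hyinf ▸ hlow⟩

theorem isComponentwiseBlockGraph_of_resistance_eq (hb : b.LocallyFinite) {w : X → X → ℝ≥0∞}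
    (hcomp : b.Compatible w) (hw : b.resistance = pathMetric w) :
    b.IsComponentwiseBlockGraph := by
  rintro x y ⟨q⟩
  obtain ⟨p, hp, -⟩ := q.exists_isInducedPath
  refine ⟨p, hp, fun p' hp' => SimpleGraph.Walk.IsInducedPath.unique ?_ hp' hp⟩
  intro x z hxz hne
  obtain ⟨y, hy, hadd⟩ :=
    b.exists_adj_resistance_add_le hb hcomp hw hne (b.resistance_ne_top hxz)
  exact ⟨y, hy, b.mem_support_of_resistance_add_le hb (b.resistance_ne_top hxz) hadd⟩

end WGraph

theorem theorem3p4 {X : Type*} [Countable X] (b : WGraph X) (hb : b.LocallyFinite) :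
    ((∃ w : X → X → ℝ≥0∞, IsWeight w ∧ b.Compatible w ∧ b.resistance = pathMetric w) ↔
        b.IsComponentwiseBlockGraph) ∧
      (b.toSimpleGraph.Preconnected →
        ((∃ w : X → X → ℝ≥0∞, IsWeight w ∧ b.Compatible w ∧ b.resistance = pathMetric w) ↔
          b.IsBlockGraph)) := by
  have main : (∃ w : X → X → ℝ≥0∞, IsWeight w ∧ b.Compatible w ∧ b.resistance = pathMetric w) ↔
      b.IsComponentwiseBlockGraph :=
    ⟨fun ⟨_, _, hcomp, hw⟩ => b.isComponentwiseBlockGraph_of_resistance_eq hb hcomp hw,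
      b.exists_weight_of_isComponentwiseBlockGraph⟩
  exact ⟨main, fun hconn => main.trans
    ⟨fun h x y => h x y (hconn x y), fun h x y _ => h x y⟩⟩
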